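/- Let $V$ be a (Hausdorff, finite-dimensional) complex manifold, let $G$ be a complex Lie group with Lie algebra $\mathfrak g$, and let $\pi:P\to V$ be a holomorphic principal $G$-bundle: $P$ is a complex manifold with a holomorphic right action of $G$, and $\pi$ is holomorphic and admits $G$-equivariant holomorphic local trivializations. Let $U$ be a real Lie subgroup of $G$ (not necessarily closed) whose Lie algebra $\mathfrak u$ is a real form of $\mathfrak g$, i.e. $\mathfrak g=\mathfrak u\oplus i\,\mathfrak u$ as real vector spaces, and let $Q=Q(V,U)$ be a reduction of $P$ to $U$: a smooth ($C^\infty$) principal $U$-bundle over $V$ together with a smooth $U$-equivariant map $f:Q\to P$ over the identity of $V$. Then there is a unique smooth connection on $Q$, with connection form $\theta$ (a $\mathfrak u$-valued $1$-form on $Q$), such that the connection form $\omega$ of its extension to $P$, that is the $\mathfrak g$-valued smooth connection form $\omega$ on $P$ with $f^*\omega=\theta$, satisfies $P^{0,1}\omega=0$. Here $P^{0,1}\omega$ is the component of type $(0,1)$ of $\omega$ on the complex manifold $P$, namely $(P^{0,1}\omega)(v)=\tfrac12\bigl(\omega(v)+i\,\omega(Jv)\bigr)$, where $J$ is the complex structure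 on the tangent spaces of $P$. -/

import Mathlib

open scoped Manifold ContDiff
open Bundle

noncomputable section

/-- A `C^n` principal bundle `P(V, G)` over the field `𝕜`, with `G` acting on `P` on the right.
With `𝕜 = ℝ` and `n = ∞` it is a differentiable principal bundle; with `𝕜 = ℂ` and `n = ω`
it is a holomorphic principal bundle (its total space carrying the canonical complex structure).
Freeness of the action and transitivity on the fibres follow from `locally_trivial`. -/
structure PrincipalBundle {𝕜 : Type*} [NontriviallyNormedField 𝕜]
    {E : Type*} [NormedAddCommGroup E] [NormedSpace 𝕜 E]
    {F : Type*} [NormedAddCommGroup F] [NormedSpace 𝕜 F]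
    {EP : Type*} [NormedAddCommGroup EP] [NormedSpace 𝕜 EP]
    (n : WithTop ℕ∞)
    (IV : ModelWithCorners 𝕜 E E) (IG : ModelWithCorners 𝕜 F F)
    (IP : ModelWithCorners 𝕜 EP EP)
    (V : Type*) [TopologicalSpace V] [ChartedSpace E V]
    (G : Type*) [TopologicalSpace G] [ChartedSpace F G] [Group G]
    (P : Type*) [TopologicalSpace P] [ChartedSpace EP P] where
  /-- the projection -/
  proj : P → V
  /-- the right action -/
  act : P → G → P
  act_one : ∀ p, act p 1 = p
  act_mul : ∀ p g h, act p (g * h) = act (act p g) h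
  proj_act : ∀ p g, proj (act p g) = proj p
  contMDiff_proj : ContMDiff IP IV n proj
  contMDiff_act : ContMDiff (IP.prod IG) IP n (fun x : P × G => act x.1 x.2)
  /-- every point of the base lies in the domain of an equivariant `C^n` local trivialization
  with `C^n` inverse -/
  locally_trivial : ∀ x : V, ∃ e : Trivialization G proj, x ∈ e.baseSet ∧
    ContMDiffOn IP (IV.prod IG) n e e.source ∧
    ContMDiffOn (IV.prod IG) IP n e.toOpenPartialHomeomorph.symm e.target ∧
    ∀ p ∈ e.source, ∀ g, (e (act p g)).2 = (e p).2 * g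

/-- A complex manifold is a real manifold with the same charts. -/
instance isManifold_real_of_complex
    {E : Type*} [NormedAddCommGroup E] [NormedSpace ℂ E]
    {M : Type*} [TopologicalSpace M] [ChartedSpace E M] [h : IsManifold 𝓘(ℂ, E) ω M] :
    IsManifold 𝓘(ℝ, E) ∞ M := by
  apply isManifold_of_contDiffOn
  intro e e' he he'
  have h1 := (contDiffGroupoid ω 𝓘(ℂ, E)).compatible he he'
  rw [contDiffGroupoid, mem_groupoid_of_pregroupoid] at h1
  have h2 : ContDiffOn ℂ ω (e.symm ≫ₕ e') ((e.symm ≫ₕ e').source ∩ Set.range id) := h1.1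
  exact (h2.restrict_scalars ℝ).of_le le_top

section Connections

variable {F : Type*} [NormedAddCommGroup F] [NormedSpace ℝ F]
  {G : Type*} [TopologicalSpace G] [ChartedSpace F G] [Group G]
  {EP : Type*} [NormedAddCommGroup EP] [NormedSpace ℝ EP]
  {P : Type*} [TopologicalSpace P] [ChartedSpace EP P]

/-- The adjoint action of `g` on the Lie algebra: the derivative at `1` of `x ↦ g x g⁻¹`
(the target tangent space, at `g 1 g⁻¹ = 1`, is the Lie algebra). -/
def adjointMap (F : Type*) [NormedAddCommGroup F] [NormedSpace ℝ F]
    {G : Type*} [TopologicalSpace G] [ChartedSpace F G] [Group G] (g : G) :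
    GroupLieAlgebra 𝓘(ℝ, F) G →L[ℝ] GroupLieAlgebra 𝓘(ℝ, F) G :=
  mfderiv (M := G) (M' := G) 𝓘(ℝ, F) 𝓘(ℝ, F) (fun x : G => g * x * g⁻¹) (1 : G)

/-- Differential `1`-forms on the real manifold `P` (no regularity required here) with values in
the Lie algebra of `G`. -/
abbrev LieValuedForm (F : Type*) [NormedAddCommGroup F] [NormedSpace ℝ F]
    (G : Type*) [TopologicalSpace G] [ChartedSpace F G] [Group G]
    (EP : Type*) [NormedAddCommGroup EP] [NormedSpace ℝ EP]
    (P : Type*) [TopologicalSpace P] [ChartedSpace EP P] :=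
  (p : P) → TangentSpace 𝓘(ℝ, EP) p →L[ℝ] GroupLieAlgebra 𝓘(ℝ, F) G

/-- `θ` is a (smooth) connection form for the right action `act` of `G` on `P`. -/
structure IsConnectionForm [IsManifold 𝓘(ℝ, EP) ∞ P] (act : P → G → P)
    (θ : LieValuedForm F G EP P) : Prop where
  smooth : ContMDiff (M' := F) 𝓘(ℝ, EP).tangent 𝓘(ℝ, F) ∞
    (fun v : TangentBundle 𝓘(ℝ, EP) P => (θ v.1 v.2 : F))
  /-- `θ` sends the value at `p = p · 1` of the fundamental vector field of `A` to `A` -/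
  fundamental : ∀ (p : P) (A : GroupLieAlgebra 𝓘(ℝ, F) G),
    θ (act p 1) (mfderiv 𝓘(ℝ, F) 𝓘(ℝ, EP) (fun g => act p g) 1 A) = A
  /-- `R_g^* θ = Ad(g⁻¹) θ` -/
  equivariant : ∀ (g : G) (p : P) (v : TangentSpace 𝓘(ℝ, EP) p),
    θ (act p g) (mfderiv 𝓘(ℝ, EP) 𝓘(ℝ, EP) (fun p => act p g) p v) =
      adjointMap F g⁻¹ (θ p v)

end Connections

section ComplexForms

/-- The canonical almost complex structure of a complex manifold, on the real tangent space at `x`.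
Mathlib identifies the tangent space at `x` with the model space through the preferred
(holomorphic) chart at `x`, so it is the multiplication by `i` there. -/
def complexJ (E : Type*) [NormedAddCommGroup E] [NormedSpace ℂ E]
    {M : Type*} [TopologicalSpace M] [ChartedSpace E M] (x : M) :
    TangentSpace 𝓘(ℝ, E) x →L[ℝ] TangentSpace 𝓘(ℝ, E) x :=
  (Complex.I • ContinuousLinearMap.id ℝ E : E →L[ℝ] E)

/-- The component `P^{0,1} ω` of type `(0,1)` of a `1`-form `ω` on a complex manifold, with values
in the Lie algebra of a complex Lie group: `v ↦ (ω v + i ω (J v)) / 2`. -/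
def zeroOnePart {F : Type*} [NormedAddCommGroup F] [NormedSpace ℂ F]
    {G : Type*} [TopologicalSpace G] [ChartedSpace F G] [Group G]
    {EP : Type*} [NormedAddCommGroup EP] [NormedSpace ℂ EP]
    {P : Type*} [TopologicalSpace P] [ChartedSpace EP P]
    (α : LieValuedForm F G EP P) : LieValuedForm F G EP P :=
  fun p => (2⁻¹ : ℝ) • (α p + (complexJ F (1 : G)).comp ((α p).comp (complexJ EP p)))

end ComplexForms

section Reductions

variable {E : Type*} [NormedAddCommGroup E] [NormedSpace ℂ E]
  {F : Type*} [NormedAddCommGroup F] [NormedSpace ℂ F]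
  {EP : Type*} [NormedAddCommGroup EP] [NormedSpace ℂ EP]
  {EU : Type*} [NormedAddCommGroup EU] [NormedSpace ℝ EU]
  {EQ : Type*} [NormedAddCommGroup EQ] [NormedSpace ℝ EQ]
  {V : Type*} [TopologicalSpace V] [ChartedSpace E V]
  {G : Type*} [TopologicalSpace G] [ChartedSpace F G] [Group G]
  {P : Type*} [TopologicalSpace P] [ChartedSpace EP P]
  {U : Type*} [TopologicalSpace U] [ChartedSpace EU U] [Group U]
  {Q : Type*} [TopologicalSpace Q] [ChartedSpace EQ Q]

/-- The map of Lie algebras induced by a group homomorphism `ι : U → G`, i.e. its derivative at `1`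
(the target tangent space, at `ι 1 = 1`, is the Lie algebra of `G`). -/
def lieAlgebraMap (EU F : Type*) [NormedAddCommGroup EU] [NormedSpace ℝ EU]
    [NormedAddCommGroup F] [NormedSpace ℝ F]
    {U : Type*} [TopologicalSpace U] [ChartedSpace EU U] [Group U]
    {G : Type*} [TopologicalSpace G] [ChartedSpace F G] [Group G] (ι : U →* G) :
    GroupLieAlgebra 𝓘(ℝ, EU) U →L[ℝ] GroupLieAlgebra 𝓘(ℝ, F) G :=
  mfderiv (M := U) (M' := G) 𝓘(ℝ, EU) 𝓘(ℝ, F) ι (1 : U)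

/-- `ι` makes `U` a real Lie subgroup (not necessarily closed) of `G`: it is a smooth injective
homomorphism, and an immersion. -/
structure IsLieSubgroup (EU F : Type*) [NormedAddCommGroup EU] [NormedSpace ℝ EU]
    [NormedAddCommGroup F] [NormedSpace ℝ F]
    {U : Type*} [TopologicalSpace U] [ChartedSpace EU U] [Group U]
    {G : Type*} [TopologicalSpace G] [ChartedSpace F G] [Group G] (ι : U →* G) : Prop where
  smooth : ContMDiff 𝓘(ℝ, EU) 𝓘(ℝ, F) ∞ ι
  injective : Function.Injective ι
  immersive : Function.Injective (lieAlgebraMap EU F ι)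

/-- The Lie algebra `𝔲` of the Lie subgroup `U` is a real form of the Lie algebra `𝔤` of the
complex Lie group `G`: `𝔤 = 𝔲 ⊕ i 𝔲` as real vector spaces. -/
def IsRealForm (EU F : Type*) [NormedAddCommGroup EU] [NormedSpace ℝ EU]
    [NormedAddCommGroup F] [NormedSpace ℂ F]
    {U : Type*} [TopologicalSpace U] [ChartedSpace EU U] [Group U]
    {G : Type*} [TopologicalSpace G] [ChartedSpace F G] [Group G] (ι : U →* G) : Prop :=
  IsCompl (lieAlgebraMap EU F ι).range
    ((lieAlgebraMap EU F ι).range.map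
      (complexJ F (1 : G) : GroupLieAlgebra 𝓘(ℝ, F) G →ₗ[ℝ] GroupLieAlgebra 𝓘(ℝ, F) G))

/-- The smooth map `f : Q → P` over the identity of `V`, equivariant with respect to `ι : U → G`,
exhibits the differentiable principal bundle `Q(V, U)` as a real subbundle (reduction to `U`) of
the holomorphic principal bundle `P(V, G)`. When `ι` is a Lie subgroup, `f` is automatically an
injective immersion. -/
structure IsReduction (BP : PrincipalBundle ω 𝓘(ℂ, E) 𝓘(ℂ, F) 𝓘(ℂ, EP) V G P)
    (BQ : PrincipalBundle ∞ 𝓘(ℝ, E) 𝓘(ℝ, EU) 𝓘(ℝ, EQ) V U Q)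
    (ι : U →* G) (f : Q → P) : Prop where
  smooth : ContMDiff 𝓘(ℝ, EQ) 𝓘(ℝ, EP) ∞ f
  proj_eq : ∀ q, BP.proj (f q) = BQ.proj q
  equivariant : ∀ q u, f (BQ.act q u) = BP.act (f q) (ι u)

/-- The connection form `α` on `P(V, G)` is the extension of the connection form `θ` on the
subbundle `Q(V, U)`: the form `α` restricts on `Q` to `θ`, that is `f^* α = ι_* θ`.
(Such an `α` is unique, by its values on vertical vectors and its equivariance.) -/
structure IsExtension [IsManifold 𝓘(ℂ, EP) ω P]
    (BP : PrincipalBundle ω 𝓘(ℂ, E) 𝓘(ℂ, F) 𝓘(ℂ, EP) V G P)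
    (ι : U →* G) (f : Q → P) (θ : LieValuedForm EU U EQ Q) (α : LieValuedForm F G EP P) :
    Prop where
  isConnectionForm : IsConnectionForm BP.act α
  restrict : ∀ (q : Q) (v : TangentSpace 𝓘(ℝ, EQ) q),
    α (f q) (mfderiv 𝓘(ℝ, EQ) 𝓘(ℝ, EP) f q v) = lieAlgebraMap EU F ι (θ q v)

end Reductions

end

noncomputable section

/-! ### Holomorphic maps, Lie groups and bundles viewed as smooth ones -/

section RestrictScalars

variable {E : Type*} [NormedAddCommGroup E] [NormedSpace ℂ E]
  {E' : Type*} [NormedAddCommGroup E'] [NormedSpace ℂ E']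
  {E'' : Type*} [NormedAddCommGroup E''] [NormedSpace ℂ E'']
  {M : Type*} [TopologicalSpace M] [ChartedSpace E M]
  {M' : Type*} [TopologicalSpace M'] [ChartedSpace E' M']
  {M'' : Type*} [TopologicalSpace M''] [ChartedSpace E'' M'']

/-! Everything reduces to the extended form `α` on `P`: it must be a connection form, be complex
linear on tangent spaces, and take values in `𝔲` on the image of `TQ`.

Uniqueness is pointwise linear algebra (`IsHolomorphicExtensionOn.eq_of_mem`). The difference of two
such forms kills vertical vectors, and at `f q` the vertical space together with the image of `T_qQ`
spans the tangent space, so there the difference takes values in `𝔲`. By complex linearity the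
values also lie in `i𝔲`, hence vanish. Equivariance carries this from `f(Q)` to all of `P`.

Existence is local (`exists_isHolomorphicExtensionOn_nhds`). Take a holomorphic fibre coordinate `ψ`
on `P` and a smooth section `s` of `Q`, and put `h = ψ ∘ f ∘ s`, `β = h⁻¹dh`. Then `ρ = (h ∘ π)⁻¹ψ`
is a fibre coordinate mapping `f(Q)` into `U`, so for any `𝔲`-valued form `a` on the base the
connection `ρ⁻¹dρ + Ad(ρ⁻¹)π^*a` restricts to a `𝔲`-valued form on `Q`. Since `ψ = (h ∘ π)ρ`, it
equals `ψ⁻¹dψ + Ad(ρ⁻¹)π^*(a - β)`. The term `ψ⁻¹dψ` is of type `(1,0)`, so it suffices that `a - β`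
be complex linear; splitting `β` into real and imaginary parts relative to `𝔲` gives `a = re β - im
β ∘ J`.

By uniqueness the local forms agree on overlaps, so they glue without a partition of unity. -/

theorem ContMDiffOn.restrictScalars_real {f : M → M'} {s : Set M}
    (hf : ContMDiffOn 𝓘(ℂ, E) 𝓘(ℂ, E') ω f s) : ContMDiffOn 𝓘(ℝ, E) 𝓘(ℝ, E') ∞ f s := by
  intro x hx
  have h := contMDiffWithinAt_iff.1 (hf x hx)
  exact contMDiffWithinAt_iff.2 ⟨h.1, (h.2.restrict_scalars ℝ).of_le le_top⟩

theorem ContMDiffOn.restrictScalars_real_prod_left {f : M × M' → M''} {s : Set (M × M')}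
    (hf : ContMDiffOn (𝓘(ℂ, E).prod 𝓘(ℂ, E')) 𝓘(ℂ, E'') ω f s) :
    ContMDiffOn (𝓘(ℝ, E).prod 𝓘(ℝ, E')) 𝓘(ℝ, E'') ∞ f s := by
  intro x hx
  have h := contMDiffWithinAt_iff.1 (hf x hx)
  exact contMDiffWithinAt_iff.2 ⟨h.1, (h.2.restrict_scalars ℝ).of_le le_top⟩

theorem ContMDiffOn.restrictScalars_real_prod_right {f : M'' → M × M'} {s : Set M''}
    (hf : ContMDiffOn 𝓘(ℂ, E'') (𝓘(ℂ, E).prod 𝓘(ℂ, E')) ω f s) :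
    ContMDiffOn 𝓘(ℝ, E'') (𝓘(ℝ, E).prod 𝓘(ℝ, E')) ∞ f s := by
  intro x hx
  have h := contMDiffWithinAt_iff.1 (hf x hx)
  exact contMDiffWithinAt_iff.2 ⟨h.1, (h.2.restrict_scalars ℝ).of_le le_top⟩

instance LieGroup.real_of_complex [Group M] [h : LieGroup 𝓘(ℂ, E) ω M] :
    LieGroup 𝓘(ℝ, E) ∞ M where
  contMDiff_mul := contMDiffOn_univ.1
    (contMDiffOn_univ.2 h.contMDiff_mul).restrictScalars_real_prod_left
  contMDiff_inv := contMDiffOn_univ.1 (contMDiffOn_univ.2 h.contMDiff_inv).restrictScalars_real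

/-- The differentiable principal bundle underlying a holomorphic one. -/
def PrincipalBundle.real {G : Type*} [TopologicalSpace G] [ChartedSpace E' G] [Group G]
    (B : PrincipalBundle ω 𝓘(ℂ, E) 𝓘(ℂ, E') 𝓘(ℂ, E'') M G M'') :
    PrincipalBundle ∞ 𝓘(ℝ, E) 𝓘(ℝ, E') 𝓘(ℝ, E'') M G M'' where
  proj := B.proj
  act := B.act
  act_one := B.act_one
  act_mul := B.act_mul
  proj_act := B.proj_act
  contMDiff_proj := contMDiffOn_univ.1 (contMDiffOn_univ.2 B.contMDiff_proj).restrictScalars_real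
  contMDiff_act := contMDiffOn_univ.1
    (contMDiffOn_univ.2 B.contMDiff_act).restrictScalars_real_prod_left
  locally_trivial x := by
    obtain ⟨e, hx, h1, h2, h3⟩ := B.locally_trivial x
    exact ⟨e, hx, h1.restrictScalars_real_prod_right, h2.restrictScalars_real_prod_left, h3⟩

end RestrictScalars

/-! ### Derivatives as maps of model spaces, and their chain rules -/

section ModelDeriv

variable (E : Type*) [NormedAddCommGroup E] [NormedSpace ℝ E]
  (E' : Type*) [NormedAddCommGroup E'] [NormedSpace ℝ E']
  {M : Type*} [TopologicalSpace M] [ChartedSpace E M]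
  {M' : Type*} [TopologicalSpace M'] [ChartedSpace E' M']

/-- The derivative of a map of manifolds, as a linear map of the model spaces: the type does not
mention the base points. -/
def modelDeriv (f : M → M') (x : M) : E →L[ℝ] E' := mfderiv 𝓘(ℝ, E) 𝓘(ℝ, E') f x

end ModelDeriv

section Calculus

variable {E : Type*} [NormedAddCommGroup E] [NormedSpace ℝ E]
  {E' : Type*} [NormedAddCommGroup E'] [NormedSpace ℝ E']
  {E'' : Type*} [NormedAddCommGroup E''] [NormedSpace ℝ E'']
  {E₃ : Type*} [NormedAddCommGroup E₃] [NormedSpace ℝ E₃]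
  {M : Type*} [TopologicalSpace M] [ChartedSpace E M]
  {M' : Type*} [TopologicalSpace M'] [ChartedSpace E' M']
  {M'' : Type*} [TopologicalSpace M''] [ChartedSpace E'' M'']
  {M₃ : Type*} [TopologicalSpace M₃] [ChartedSpace E₃ M₃]

open Filter Topology

theorem modelDeriv_congr {f g : M → M'} {x : M} (h : f =ᶠ[𝓝 x] g) :
    modelDeriv E E' f x = modelDeriv E E' g x :=
  h.mfderiv_eq

/-- The chain rule. -/
theorem modelDeriv_comp {k : M → M''} {g : M' → M''} {f : M → M'} {x : M} {y : M'}
    (hg : MDifferentiableAt 𝓘(ℝ, E') 𝓘(ℝ, E'') g y)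
    (hf : MDifferentiableAt 𝓘(ℝ, E) 𝓘(ℝ, E') f x) (hy : f x = y)
    (hk : ∀ᶠ z in 𝓝 x, k z = g (f z)) (v : E) :
    modelDeriv E E'' k x v = modelDeriv E' E'' g y (modelDeriv E E' f x v) := by
  subst hy
  rw [modelDeriv_congr (g := g ∘ f) hk]
  exact DFunLike.congr_fun (mfderiv_comp x hg hf) v

theorem modelDeriv_id {k : M → M} {x : M} (hk : ∀ᶠ z in 𝓝 x, k z = z) (v : E) :
    modelDeriv E E k x v = v := by
  rw [modelDeriv_congr (g := id) hk]
  exact DFunLike.congr_fun mfderiv_id v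

theorem modelDeriv_const {k : M → M'} {x : M} {y : M'} (hk : ∀ᶠ z in 𝓝 x, k z = y) (v : E) :
    modelDeriv E E' k x v = 0 := by
  rw [modelDeriv_congr (g := fun _ => y) hk]
  exact DFunLike.congr_fun (mfderiv_const (c := y)) v

/-- The derivative of a map of two variables composed with a pair of maps. -/
theorem modelDeriv_comp₂ {k : M → M₃} {c : M' → M'' → M₃} {a : M → M'} {b : M → M''}
    {x : M} {y : M'} {z : M''}
    (hc : MDifferentiableAt (𝓘(ℝ, E').prod 𝓘(ℝ, E'')) 𝓘(ℝ, E₃)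
      (fun q : M' × M'' => c q.1 q.2) (y, z))
    (ha : MDifferentiableAt 𝓘(ℝ, E) 𝓘(ℝ, E') a x)
    (hb : MDifferentiableAt 𝓘(ℝ, E) 𝓘(ℝ, E'') b x) (hy : a x = y) (hz : b x = z)
    (hk : ∀ᶠ t in 𝓝 x, k t = c (a t) (b t)) (v : E) :
    modelDeriv E E₃ k x v = modelDeriv E' E₃ (fun t => c t z) y (modelDeriv E E' a x v) +
      modelDeriv E'' E₃ (c y) z (modelDeriv E E'' b x v) := by
  subst hy hz
  rw [modelDeriv_congr (g := (fun q : M' × M'' => c q.1 q.2) ∘ fun t => (a t, b t)) hk]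
  refine (DFunLike.congr_fun (mfderiv_comp x hc (ha.prodMk hb)) v).trans ?_
  refine (mfderiv_prod_eq_add_apply hc).trans ?_
  rw [mfderiv_prodMk ha hb]
  rfl

end Calculus

section ComplexLinear

variable {E : Type*} [NormedAddCommGroup E] [NormedSpace ℂ E]
  {E' : Type*} [NormedAddCommGroup E'] [NormedSpace ℂ E']
  {M : Type*} [TopologicalSpace M] [ChartedSpace E M]
  {M' : Type*} [TopologicalSpace M'] [ChartedSpace E' M']

/-- The real and complex derivatives are read in the same charts, so the real one is the complex one
with scalars restricted. -/
theorem modelDeriv_I_smul {f : M → M'} {x : M} (hf : MDifferentiableAt 𝓘(ℂ, E) 𝓘(ℂ, E') f x)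
    (v : E) : modelDeriv E E' f x (Complex.I • v) = Complex.I • modelDeriv E E' f x v := by
  have h := hf.hasMFDerivAt
  have h' : HasMFDerivAt 𝓘(ℝ, E) 𝓘(ℝ, E') f x
      ((show E →L[ℂ] E' from mfderiv 𝓘(ℂ, E) 𝓘(ℂ, E') f x).restrictScalars ℝ) :=
    ⟨h.1, HasFDerivWithinAt.restrictScalars ℝ h.2⟩
  rw [modelDeriv, h'.mfderiv]
  exact (show E →L[ℂ] E' from mfderiv 𝓘(ℂ, E) 𝓘(ℂ, E') f x).map_smul Complex.I v

end ComplexLinear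

/-! ### Smoothness of maps between tangent bundles -/

section TangentBundleSmoothness

open Filter Topology

variable {E : Type*} [NormedAddCommGroup E] [NormedSpace ℝ E]
  {E' : Type*} [NormedAddCommGroup E'] [NormedSpace ℝ E']
  {EN : Type*} [NormedAddCommGroup EN] [NormedSpace ℝ EN]
  {M : Type*} [TopologicalSpace M] [ChartedSpace E M] [IsManifold 𝓘(ℝ, E) ∞ M]
  {M' : Type*} [TopologicalSpace M'] [ChartedSpace E' M'] [IsManifold 𝓘(ℝ, E') ∞ M']
  {N : Type*} [TopologicalSpace N] [ChartedSpace EN N] [IsManifold 𝓘(ℝ, EN) ∞ N]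
  {EZ : Type*} [NormedAddCommGroup EZ] [NormedSpace ℝ EZ] {HZ : Type*} [TopologicalSpace HZ]
  {J : ModelWithCorners ℝ EZ HZ} {Z : Type*} [TopologicalSpace Z] [ChartedSpace HZ Z]

/-- The coordinates of a tangent vector in the preferred chart at its base point. -/
def TangentBundle.vec {M : Type*} [TopologicalSpace M] [ChartedSpace E M]
    (v : TangentBundle 𝓘(ℝ, E) M) : E := v.2

/-- The tangent vector with given coordinates in the preferred chart at its base point. -/
def TangentBundle.ofVec {M : Type*} [TopologicalSpace M] [ChartedSpace E M] (x : M) (w : E) :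
    TangentBundle 𝓘(ℝ, E) M := ⟨x, w⟩

theorem TangentBundle.trivializationAt_mk (x : M) (v : TangentSpace 𝓘(ℝ, E) x) :
    (trivializationAt E (TangentSpace 𝓘(ℝ, E)) x ⟨x, v⟩).2 = v :=
  congrArg Prod.snd ((tangentBundleCore 𝓘(ℝ, E) M).localTrivAt_apply_mk x v)

/-- A smooth map to the tangent bundle with constant base point is smooth as a vector-valued
map. -/
theorem ContMDiff.fiber_of_base_eq {k : Z → TangentBundle 𝓘(ℝ, E) M}
    (hk : ContMDiff J 𝓘(ℝ, E).tangent ∞ k) (y : M) (hy : ∀ z, (k z).1 = y) :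
    ContMDiff J 𝓘(ℝ, E) ∞ (fun z => (k z).vec) := by
  intro z
  have h := ((contMDiffAt_totalSpace).1 (hk z)).2
  refine h.congr_of_eventuallyEq (Eventually.of_forall fun t => ?_)
  -- The base points are equal but not definitionally so; quantifying over both vectors lets the
  -- equality be eliminated.
  have key : ∀ a b : TangentBundle 𝓘(ℝ, E) M, a.1 = b.1 →
      (trivializationAt E (TangentSpace 𝓘(ℝ, E)) a.1 b).2 = (b.2 : E) := by
    rintro ⟨a, v⟩ ⟨b, w⟩ (rfl : a = b)
    exact TangentBundle.trivializationAt_mk a w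
  exact (key (k z) (k t) (by rw [hy, hy])).symm

theorem contMDiff_tangentBundle_mk (x : M) :
    ContMDiff 𝓘(ℝ, E) 𝓘(ℝ, E).tangent ∞
      (fun v : E => TangentBundle.ofVec x v) := by
  intro v
  refine (contMDiffAt_totalSpace).2 ⟨contMDiffAt_const, ?_⟩
  refine contMDiffAt_id.congr_of_eventuallyEq (Eventually.of_forall fun t => ?_)
  exact TangentBundle.trivializationAt_mk x t

/-- The tangent map in the second variable is smooth in both variables. -/
theorem contMDiff_tangentMap_right {c : N → M → M'}
    (hc : ContMDiff (𝓘(ℝ, EN).prod 𝓘(ℝ, E)) 𝓘(ℝ, E') ∞ (fun q : N × M => c q.1 q.2)) :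
    ContMDiff (𝓘(ℝ, EN).prod 𝓘(ℝ, E).tangent) 𝓘(ℝ, E').tangent ∞
      (fun x : N × TangentBundle 𝓘(ℝ, E) M =>
        TangentBundle.ofVec (c x.1 x.2.1) (modelDeriv E E' (c x.1) x.2.1 x.2.vec)) := by
  -- The partial derivative is the full tangent map of `c` evaluated on `(0, v)`; the zero section
  -- supplies the first component smoothly.
  have S₀ : ContMDiff 𝓘(ℝ, EN) 𝓘(ℝ, EN).tangent ∞
      (fun n : N => (⟨n, 0⟩ : TangentBundle 𝓘(ℝ, EN) N)) :=
    contMDiff_zeroSection ℝ (TangentSpace 𝓘(ℝ, EN) : N → Type _)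
  have S₁ := (S₀.comp contMDiff_fst).prodMk
    (contMDiff_snd (I := 𝓘(ℝ, EN)) (J := 𝓘(ℝ, E).tangent) (M := N)
      (N := TangentBundle 𝓘(ℝ, E) M) (n := ∞))
  have S₂ : ContMDiff (𝓘(ℝ, EN).tangent.prod 𝓘(ℝ, E).tangent) (𝓘(ℝ, EN).prod 𝓘(ℝ, E)).tangent ∞
      (equivTangentBundleProd 𝓘(ℝ, EN) N 𝓘(ℝ, E) M).symm := contMDiff_equivTangentBundleProd_symm
  have S₃ := hc.contMDiff_tangentMap (m := ∞) le_rfl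
  refine ((S₃.comp S₂).comp S₁).congr fun x => ?_
  have hd := (hc (x.1, x.2.1)).mdifferentiableAt (by simp)
  have := mfderiv_prod_eq_add_apply (v := ((0 : EN), x.2.vec)) hd
  simp only [Function.comp, tangentMap]
  refine congrArg (TangentBundle.ofVec (c x.1 x.2.1)) ?_
  refine Eq.trans ?_ this.symm
  have h0 : modelDeriv EN E' (fun z => c z x.2.1) x.1 0 = 0 := map_zero _
  exact (zero_add (modelDeriv E E' (c x.1) x.2.1 x.2.vec)).symm.trans
    (congrArg (· + modelDeriv E E' (c x.1) x.2.1 x.2.vec) h0.symm)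

theorem ContMDiffOn.tangentMap_of_isOpen {f : M → M'} {s : Set M} (hs : IsOpen s)
    (hf : ContMDiffOn 𝓘(ℝ, E) 𝓘(ℝ, E') ∞ f s) :
    ContMDiffOn 𝓘(ℝ, E).tangent 𝓘(ℝ, E').tangent ∞
      (fun v : TangentBundle 𝓘(ℝ, E) M =>
        TangentBundle.ofVec (f v.1) (modelDeriv E E' f v.1 v.vec))
      (TotalSpace.proj ⁻¹' s) := by
  refine (hf.contMDiffOn_tangentMapWithin (m := ∞) le_rfl hs.uniqueMDiffOn).congr fun v hv => ?_
  simp only [tangentMapWithin]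
  rw [mfderivWithin_of_isOpen hs hv]
  rfl

end TangentBundleSmoothness

section ComplexStructure

variable {E : Type*} [NormedAddCommGroup E] [NormedSpace ℂ E]
  {M : Type*} [TopologicalSpace M] [ChartedSpace E M] [IsManifold 𝓘(ℂ, E) ω M]

/-- Multiplication by `i` is smooth on the tangent bundle of a complex manifold. -/
theorem contMDiff_tangentBundle_I_smul :
    ContMDiff 𝓘(ℝ, E).tangent 𝓘(ℝ, E).tangent ∞
      (fun v : TangentBundle 𝓘(ℝ, E) M =>
        TangentBundle.ofVec v.1 (Complex.I • v.vec)) := by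
  intro v₀
  have h := (contMDiffAt_totalSpace (n := ∞)).1
    (contMDiffAt_id (I := 𝓘(ℝ, E).tangent) (x := v₀))
  refine (contMDiffAt_totalSpace).2 ⟨h.1, ?_⟩
  have hI : ContMDiff 𝓘(ℝ, E) 𝓘(ℝ, E) ∞ (fun w : E => Complex.I • w) :=
    (contDiff_const_smul Complex.I).contMDiff
  refine (hI.contMDiffAt.comp v₀ h.2).congr_of_eventuallyEq ?_
  have hU : (TotalSpace.proj ⁻¹' (chartAt E v₀.1).source : Set (TangentBundle 𝓘(ℝ, E) M)) ∈
      nhds v₀ :=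
    ((chartAt E v₀.1).open_source.preimage (FiberBundle.continuous_proj E _)).mem_nhds
      (mem_chart_source E v₀.1)
  filter_upwards [hU] with v hv
  -- The tangent trivialization at `v₀.1` is the derivative of the chart there, and that chart is
  -- holomorphic, so it commutes with `i`.
  have key : ∀ w : E, (trivializationAt E (TangentSpace 𝓘(ℝ, E)) v₀.1
      (TangentBundle.ofVec v.1 w)).2 =
      modelDeriv E E (extChartAt 𝓘(ℝ, E) v₀.1) v.1 w := by
    intro w
    have := TangentBundle.continuousLinearMapAt_trivializationAt (I := 𝓘(ℝ, E)) hv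
    have h2 := DFunLike.congr_fun this w
    refine Eq.trans ?_ h2
    have h3 := (trivializationAt E (TangentSpace 𝓘(ℝ, E)) v₀.1).linearMapAt_apply (R := ℝ)
      (b := v.1) w
    exact (h3.trans (if_pos hv)).symm
  refine (key (Complex.I • v.vec)).trans ?_
  rw [modelDeriv_I_smul]
  · exact congrArg (Complex.I • ·) (key v.vec).symm
  · exact mdifferentiableAt_extChartAt (I := 𝓘(ℂ, E)) hv

end ComplexStructure

/-! ### The Maurer–Cartan form and the adjoint action -/

section MaurerCartan

open Filter Topology

variable (F : Type*) [NormedAddCommGroup F] [NormedSpace ℝ F]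
  {G : Type*} [TopologicalSpace G] [ChartedSpace F G] [Group G]

/-- The Maurer–Cartan form `g⁻¹ dg`. -/
def maurerCartan (g : G) : F →L[ℝ] F := modelDeriv F F (fun x : G => g⁻¹ * x) g

/-- The adjoint representation, as endomorphisms of the model space. -/
def modelAd (g : G) : F →L[ℝ] F := modelDeriv F F (fun x : G => g * x * g⁻¹) 1

variable {F}
variable {EU : Type*} [NormedAddCommGroup EU] [NormedSpace ℝ EU]
  {U : Type*} [TopologicalSpace U] [ChartedSpace EU U] [Group U]
  {E : Type*} [NormedAddCommGroup E] [NormedSpace ℝ E]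
  {M : Type*} [TopologicalSpace M] [ChartedSpace E M]

section
variable [LieGroup 𝓘(ℝ, F) ∞ G]

theorem mdifferentiableAt_mul_left' (a x : G) :
    MDifferentiableAt 𝓘(ℝ, F) 𝓘(ℝ, F) (fun y => a * y) x :=
  (contMDiff_mul_left (I := 𝓘(ℝ, F)) (n := ∞) (a := a)).contMDiffAt.mdifferentiableAt (by simp)

theorem mdifferentiableAt_mul_right' (a x : G) :
    MDifferentiableAt 𝓘(ℝ, F) 𝓘(ℝ, F) (fun y => y * a) x :=
  (contMDiff_mul_right (I := 𝓘(ℝ, F)) (n := ∞) (a := a)).contMDiffAt.mdifferentiableAt (by simp)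

theorem mdifferentiableAt_conj (a x : G) :
    MDifferentiableAt 𝓘(ℝ, F) 𝓘(ℝ, F) (fun y => a * y * a⁻¹) x :=
  MDifferentiableAt.comp x (mdifferentiableAt_mul_right' a⁻¹ _) (mdifferentiableAt_mul_left' a x)

/-- Translating before differentiating turns identities between Maurer–Cartan forms into identities
in the group. -/
theorem maurerCartan_modelDeriv {f : M → G} {x : M}
    (hf : MDifferentiableAt 𝓘(ℝ, E) 𝓘(ℝ, F) f x) {g : G} (hg : f x = g) (v : E) :
    maurerCartan F g (modelDeriv E F f x v) = modelDeriv E F (fun y => g⁻¹ * f y) x v :=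
  (modelDeriv_comp (mdifferentiableAt_mul_left' g⁻¹ g) hf hg (Eventually.of_forall fun _ => rfl)
    v).symm

theorem modelAd_modelDeriv {f : M → G} {x : M}
    (hf : MDifferentiableAt 𝓘(ℝ, E) 𝓘(ℝ, F) f x) (g : G) (h1 : f x = 1) (v : E) :
    modelAd F g (modelDeriv E F f x v) = modelDeriv E F (fun y => g * f y * g⁻¹) x v :=
  (modelDeriv_comp (mdifferentiableAt_conj g 1) hf h1 (Eventually.of_forall fun _ => rfl) v).symm

theorem modelAd_mul (g h : G) (v : F) : modelAd F (g * h) v = modelAd F g (modelAd F h v) := by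
  conv_rhs => rw [modelAd.eq_def F h]
  rw [modelAd_modelDeriv (mdifferentiableAt_conj h 1) g (by simp), modelAd]
  congr 2
  ext y
  simp [mul_assoc]

/-- The Maurer–Cartan form of a product of maps. -/
theorem maurerCartan_mul {k a b : M → G} {x : M}
    (ha : MDifferentiableAt 𝓘(ℝ, E) 𝓘(ℝ, F) a x) (hb : MDifferentiableAt 𝓘(ℝ, E) 𝓘(ℝ, F) b x)
    (hk : ∀ᶠ z in 𝓝 x, k z = a z * b z) (v : E) :
    maurerCartan F (k x) (modelDeriv E F k x v) =
      maurerCartan F (b x) (modelDeriv E F b x v) +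
        modelAd F (b x)⁻¹ (maurerCartan F (a x) (modelDeriv E F a x v)) := by
  have hkx := hk.self_of_nhds
  have hmul : MDifferentiableAt (𝓘(ℝ, F).prod 𝓘(ℝ, F)) 𝓘(ℝ, F)
      (fun q : G × G => q.1 * q.2) (a x, b x) :=
    (contMDiff_mul 𝓘(ℝ, F) ∞).contMDiffAt.mdifferentiableAt (by simp)
  rw [modelDeriv_comp₂ (c := fun s t : G => s * t) hmul ha hb rfl rfl hk, map_add, add_comm]
  congr 1
  · rw [maurerCartan_modelDeriv (mdifferentiableAt_mul_left' _ _) hkx.symm]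
    have : (fun y => (k x)⁻¹ * (a x * y)) = fun y => (b x)⁻¹ * y := by
      ext y; rw [hkx]; group
    rw [this]; rfl
  -- Here the group identity is `(a x * b x)⁻¹ * (a y * b x) = (b x)⁻¹ * ((a x)⁻¹ * a y) * b x`,
  -- which produces the adjoint factor.
  · rw [maurerCartan_modelDeriv (mdifferentiableAt_mul_right' _ _) hkx.symm, maurerCartan,
      modelAd_modelDeriv (mdifferentiableAt_mul_left' _ _) _ (by simp)]
    congr 2
    ext y; rw [hkx]; group

theorem maurerCartan_mul_const {k a : M → G} {x : M}
    (ha : MDifferentiableAt 𝓘(ℝ, E) 𝓘(ℝ, F) a x) (g : G)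
    (hk : ∀ᶠ z in 𝓝 x, k z = a z * g) (v : E) :
    maurerCartan F (k x) (modelDeriv E F k x v) =
      modelAd F g⁻¹ (maurerCartan F (a x) (modelDeriv E F a x v)) := by
  rw [maurerCartan_mul ha (mdifferentiableAt_const (c := g)) hk,
    modelDeriv_const (Eventually.of_forall fun _ => rfl), map_zero, zero_add]

/-- The form is the derivative in `b` of `(a, b) ↦ a⁻¹ * b` on the diagonal, where the value is
constantly `1`; the tangent map therefore lands in a single fibre. -/
theorem contMDiff_maurerCartan :
    ContMDiff 𝓘(ℝ, F).tangent 𝓘(ℝ, F) ∞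
      (fun v : TangentBundle 𝓘(ℝ, F) G => maurerCartan F v.1 v.vec) := by
  have hc : ContMDiff (𝓘(ℝ, F).prod 𝓘(ℝ, F)) 𝓘(ℝ, F) ∞ (fun q : G × G => q.1⁻¹ * q.2) :=
    contMDiff_fst.inv.mul contMDiff_snd
  have h := (contMDiff_tangentMap_right (c := fun a b : G => a⁻¹ * b) hc).comp
    ((contMDiff_proj (TangentSpace 𝓘(ℝ, F) : G → Type _)).prodMk contMDiff_id)
  exact h.fiber_of_base_eq 1 fun v => inv_mul_cancel _

theorem contMDiff_modelAd :
    ContMDiff (𝓘(ℝ, F).prod 𝓘(ℝ, F)) 𝓘(ℝ, F) ∞ (fun q : G × F => modelAd F q.1 q.2) := by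
  have hc : ContMDiff (𝓘(ℝ, F).prod 𝓘(ℝ, F)) 𝓘(ℝ, F) ∞
      (fun q : G × G => q.1 * q.2 * q.1⁻¹) :=
    (contMDiff_fst.mul contMDiff_snd).mul contMDiff_fst.inv
  have h := (contMDiff_tangentMap_right (c := fun a b : G => a * b * a⁻¹) hc).comp
    (contMDiff_fst.prodMk ((contMDiff_tangentBundle_mk (1 : G)).comp contMDiff_snd))
  exact h.fiber_of_base_eq 1 fun q => by simp [TangentBundle.ofVec]

variable [LieGroup 𝓘(ℝ, EU) ∞ U] {ι : U →* G}

theorem maurerCartan_map {k : M → G} {a : M → U} {x : M}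
    (hι : ContMDiff 𝓘(ℝ, EU) 𝓘(ℝ, F) ∞ ι)
    (ha : MDifferentiableAt 𝓘(ℝ, E) 𝓘(ℝ, EU) a x) (hk : ∀ᶠ z in 𝓝 x, k z = ι (a z)) (v : E) :
    maurerCartan F (k x) (modelDeriv E F k x v) =
      modelDeriv EU F ι 1 (maurerCartan EU (a x) (modelDeriv E EU a x v)) := by
  have hd : ∀ u, MDifferentiableAt 𝓘(ℝ, EU) 𝓘(ℝ, F) ι u :=
    fun u => hι.contMDiffAt.mdifferentiableAt (by simp)
  have hkx := hk.self_of_nhds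
  rw [modelDeriv_comp (hd (a x)) ha rfl hk, maurerCartan_modelDeriv (hd _) hkx.symm, maurerCartan,
    ← modelDeriv_comp (k := fun y => ι ((a x)⁻¹ * y)) (hd 1)
      (mdifferentiableAt_mul_left' (a x)⁻¹ (a x)) (by simp) (Eventually.of_forall fun _ => rfl)]
  congr 2
  ext y
  simp [hkx]

theorem modelAd_map (hι : ContMDiff 𝓘(ℝ, EU) 𝓘(ℝ, F) ∞ ι) (u : U) (v : EU) :
    modelAd F (ι u) (modelDeriv EU F ι 1 v) = modelDeriv EU F ι 1 (modelAd EU u v) := by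
  have hd : MDifferentiableAt 𝓘(ℝ, EU) 𝓘(ℝ, F) ι 1 :=
    hι.contMDiffAt.mdifferentiableAt (by simp)
  rw [modelAd_modelDeriv hd _ (by simp), modelAd,
    ← modelDeriv_comp (k := fun y => ι (u * y * u⁻¹)) hd
      (mdifferentiableAt_conj u 1) (by simp) (Eventually.of_forall fun _ => rfl)]
  congr 2
  ext y
  simp

end

end MaurerCartan

section ComplexMaurerCartan

variable {F : Type*} [NormedAddCommGroup F] [NormedSpace ℂ F]
  {G : Type*} [TopologicalSpace G] [ChartedSpace F G] [Group G] [LieGroup 𝓘(ℂ, F) ω G]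

theorem maurerCartan_I_smul (g : G) (v : F) :
    maurerCartan F g (Complex.I • v) = Complex.I • maurerCartan F g v :=
  modelDeriv_I_smul ((contMDiff_mul_left (I := 𝓘(ℂ, F)) (n := ω)).contMDiffAt.mdifferentiableAt
    (by simp)) v

theorem modelAd_I_smul (g : G) (v : F) :
    modelAd F g (Complex.I • v) = Complex.I • modelAd F g v :=
  modelDeriv_I_smul (((contMDiff_mul_right (I := 𝓘(ℂ, F)) (n := ω)).comp
    (contMDiff_mul_left (I := 𝓘(ℂ, F)) (n := ω))).contMDiffAt.mdifferentiableAt (by simp)) v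

end ComplexMaurerCartan

/-! ### Local sections, vertical vectors and fibres of principal bundles -/

namespace PrincipalBundle

open Filter Topology

section General

variable {𝕜 : Type*} [NontriviallyNormedField 𝕜]
  {E : Type*} [NormedAddCommGroup E] [NormedSpace 𝕜 E]
  {F : Type*} [NormedAddCommGroup F] [NormedSpace 𝕜 F]
  {EP : Type*} [NormedAddCommGroup EP] [NormedSpace 𝕜 EP]
  {n : WithTop ℕ∞}
  {IV : ModelWithCorners 𝕜 E E} {IG : ModelWithCorners 𝕜 F F}
  {IP : ModelWithCorners 𝕜 EP EP}
  {V : Type*} [TopologicalSpace V] [ChartedSpace E V]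
  {G : Type*} [TopologicalSpace G] [ChartedSpace F G] [Group G]
  {P : Type*} [TopologicalSpace P] [ChartedSpace EP P]

/-- Around each point of the base there are a section and the corresponding fibre coordinate. -/
theorem exists_section (B : PrincipalBundle n IV IG IP V G P) (x : V) :
    ∃ O : Set V, IsOpen O ∧ x ∈ O ∧ ∃ (s : V → P) (ψ : P → G),
      ContMDiffOn IV IP n s O ∧ ContMDiffOn IP IG n ψ (B.proj ⁻¹' O) ∧
      (∀ y ∈ O, B.proj (s y) = y) ∧ (∀ y ∈ O, ψ (s y) = 1) ∧
      (∀ p, B.proj p ∈ O → ∀ g, ψ (B.act p g) = ψ p * g) ∧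
      (∀ p, B.proj p ∈ O → B.act (s (B.proj p)) (ψ p) = p) := by
  obtain ⟨e, hx, he, he', hact⟩ := B.locally_trivial x
  have hmem : ∀ (y : V) (g : G), y ∈ e.baseSet → (y, g) ∈ e.target := fun y g hy => by
    rw [e.target_eq]; exact ⟨hy, trivial⟩
  have hsrc : e.source = B.proj ⁻¹' e.baseSet := e.source_eq
  have hproj : ∀ y ∈ e.baseSet, B.proj (e.toOpenPartialHomeomorph.symm (y, 1)) = y :=
    fun y hy => e.proj_symm_apply (hmem y 1 hy)
  have hes : ∀ y ∈ e.baseSet, e (e.toOpenPartialHomeomorph.symm (y, 1)) = (y, 1) :=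
    fun y hy => e.apply_symm_apply (hmem y 1 hy)
  refine ⟨e.baseSet, e.open_baseSet, hx, fun y => e.toOpenPartialHomeomorph.symm (y, 1),
    fun p => (e p).2, ?_, ?_, hproj, fun y hy => congrArg Prod.snd (hes y hy), ?_, ?_⟩
  · exact he'.comp (contMDiff_id.prodMk contMDiff_const).contMDiffOn fun y hy => hmem y 1 hy
  · rw [← hsrc]
    exact contMDiff_snd.comp_contMDiffOn he
  · intro p hp g
    exact hact p (by rw [hsrc]; exact hp) g
  · intro p hp
    have h1 : e.toOpenPartialHomeomorph.symm (B.proj p, 1) ∈ e.source := by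
      rw [hsrc, Set.mem_preimage, hproj _ hp]; exact hp
    have h2 : p ∈ e.source := by rw [hsrc]; exact hp
    have h3 : B.act (e.toOpenPartialHomeomorph.symm (B.proj p, 1)) (e p).2 ∈ e.source := by
      rw [hsrc, Set.mem_preimage, B.proj_act, hproj _ hp]; exact hp
    refine e.injOn h3 h2 (show e _ = e p from Prod.ext ?_ ?_)
    · rw [e.coe_fst h3, e.coe_fst h2, B.proj_act, hproj _ hp]
    · rw [hact _ h1, hes _ hp, one_mul]

end General

variable {E : Type*} [NormedAddCommGroup E] [NormedSpace ℝ E]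
  {F : Type*} [NormedAddCommGroup F] [NormedSpace ℝ F]
  {EP : Type*} [NormedAddCommGroup EP] [NormedSpace ℝ EP]
  {V : Type*} [TopologicalSpace V] [ChartedSpace E V]
  {G : Type*} [TopologicalSpace G] [ChartedSpace F G] [Group G]
  {P : Type*} [TopologicalSpace P] [ChartedSpace EP P]
  (B : PrincipalBundle ∞ 𝓘(ℝ, E) 𝓘(ℝ, F) 𝓘(ℝ, EP) V G P)

theorem mdifferentiableAt_proj (p : P) : MDifferentiableAt 𝓘(ℝ, EP) 𝓘(ℝ, E) B.proj p :=
  B.contMDiff_proj.contMDiffAt.mdifferentiableAt (by simp)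

theorem mdifferentiableAt_act (p : P) (g : G) :
    MDifferentiableAt (𝓘(ℝ, EP).prod 𝓘(ℝ, F)) 𝓘(ℝ, EP) (fun x : P × G => B.act x.1 x.2) (p, g) :=
  B.contMDiff_act.contMDiffAt.mdifferentiableAt (by simp)

theorem mdifferentiableAt_act_left (p : P) (g : G) :
    MDifferentiableAt 𝓘(ℝ, F) 𝓘(ℝ, EP) (B.act p) g :=
  MDifferentiableAt.comp (f := fun g : G => (p, g)) g (B.mdifferentiableAt_act p g)
    (mdifferentiableAt_const.prodMk mdifferentiableAt_id)

theorem mdifferentiableAt_act_right (p : P) (g : G) :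
    MDifferentiableAt 𝓘(ℝ, EP) 𝓘(ℝ, EP) (fun p => B.act p g) p :=
  MDifferentiableAt.comp (f := fun p : P => (p, g)) p (B.mdifferentiableAt_act p g)
    (mdifferentiableAt_id.prodMk mdifferentiableAt_const)

theorem modelDeriv_proj_act_left (p : P) (g : G) (A : F) :
    modelDeriv EP E B.proj (B.act p g) (modelDeriv F EP (B.act p) g A) = 0 := by
  rw [← modelDeriv_comp (k := fun g => B.proj (B.act p g)) (B.mdifferentiableAt_proj _)
    (B.mdifferentiableAt_act_left p g) rfl (Eventually.of_forall fun _ => rfl)]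
  exact modelDeriv_const (Eventually.of_forall fun g => B.proj_act p g) A

theorem modelDeriv_proj_fundamental (p : P) (A : F) :
    modelDeriv EP E B.proj p (modelDeriv F EP (B.act p) 1 A) = 0 := by
  have := B.modelDeriv_proj_act_left p 1 A
  rwa [B.act_one] at this

theorem modelDeriv_proj_act_right (p : P) (g : G) (v : EP) :
    modelDeriv EP E B.proj (B.act p g) (modelDeriv EP EP (fun p => B.act p g) p v) =
      modelDeriv EP E B.proj p v := by
  rw [← modelDeriv_comp (k := fun p => B.proj (B.act p g)) (B.mdifferentiableAt_proj _)
    (B.mdifferentiableAt_act_right p g) rfl (Eventually.of_forall fun _ => rfl)]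
  congr 2
  ext p
  exact B.proj_act p g

theorem isOpen_preimage {O : Set V} (hO : IsOpen O) : IsOpen (B.proj ⁻¹' O) :=
  hO.preimage B.contMDiff_proj.continuous

/-- The projection is a submersion. -/
theorem exists_modelDeriv_proj_eq (p : P) (w : E) : ∃ v, modelDeriv EP E B.proj p v = w := by
  obtain ⟨O, hO, hp, s, ψ, hs, -, hps, -, -, hsψ⟩ := B.exists_section (B.proj p)
  have hds : MDifferentiableAt 𝓘(ℝ, E) 𝓘(ℝ, EP) s (B.proj p) :=
    (hs.contMDiffAt (hO.mem_nhds hp)).mdifferentiableAt (by simp)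
  have hd : MDifferentiableAt 𝓘(ℝ, E) 𝓘(ℝ, EP) (fun y => B.act (s y) (ψ p)) (B.proj p) :=
    MDifferentiableAt.comp _ (B.mdifferentiableAt_act_right _ _) hds
  -- The local section is translated by `ψ p` so that it passes through `p`.
  refine ⟨modelDeriv E EP (fun y => B.act (s y) (ψ p)) (B.proj p) w, ?_⟩
  rw [← modelDeriv_comp (k := fun y => B.proj (B.act (s y) (ψ p))) (B.mdifferentiableAt_proj p) hd
    (hsψ p hp) (Eventually.of_forall fun _ => rfl)]
  refine modelDeriv_id ?_ w
  filter_upwards [hO.mem_nhds hp] with y hy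
  rw [B.proj_act, hps y hy]

/-- Vertical vectors are values of fundamental vector fields. -/
theorem exists_fundamental_eq [LieGroup 𝓘(ℝ, F) ∞ G] {p : P} {v : EP}
    (hv : modelDeriv EP E B.proj p v = 0) : ∃ A : F, modelDeriv F EP (B.act p) 1 A = v := by
  obtain ⟨O, hO, hp, s, ψ, hs, hψ, hps, -, -, hsψ⟩ := B.exists_section (B.proj p)
  have hds : MDifferentiableAt 𝓘(ℝ, E) 𝓘(ℝ, EP) s (B.proj p) :=
    (hs.contMDiffAt (hO.mem_nhds hp)).mdifferentiableAt (by simp)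
  have hOp := (B.isOpen_preimage hO).mem_nhds (show p ∈ B.proj ⁻¹' O from hp)
  have hdψ : MDifferentiableAt 𝓘(ℝ, EP) 𝓘(ℝ, F) ψ p :=
    (hψ.contMDiffAt hOp).mdifferentiableAt (by simp)
  -- Differentiate `t = s(π t) · ψ(t)` at `p`: the contribution of `s ∘ π` vanishes on the vertical
  -- vector `v`, leaving only that of `ψ`.
  have h1 : modelDeriv EP EP (fun t : P => t) p v = _ :=
    modelDeriv_comp₂ (c := B.act) (a := fun t => s (B.proj t)) (b := ψ)
      (B.mdifferentiableAt_act _ _) (MDifferentiableAt.comp p hds (B.mdifferentiableAt_proj p))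
      hdψ rfl rfl (by filter_upwards [hOp] with t ht using (hsψ t ht).symm) v
  rw [modelDeriv_id (Eventually.of_forall fun _ => rfl),
    modelDeriv_comp (k := fun t => s (B.proj t)) hds (B.mdifferentiableAt_proj p) rfl
      (Eventually.of_forall fun _ => rfl), hv, map_zero, map_zero, zero_add] at h1
  refine ⟨maurerCartan F (ψ p) (modelDeriv EP F ψ p v), ?_⟩
  rw [maurerCartan, ← modelDeriv_comp (k := B.act (s (B.proj p)))
    (B.mdifferentiableAt_act_left p 1) (mdifferentiableAt_mul_left' _ _) (by simp), ← h1]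
  refine Eventually.of_forall fun g => ?_
  have hs' : B.act p (ψ p)⁻¹ = s (B.proj p) := calc
    B.act p (ψ p)⁻¹ = B.act (B.act (s (B.proj p)) (ψ p)) (ψ p)⁻¹ := by rw [hsψ p hp]
    _ = s (B.proj p) := by rw [← B.act_mul, mul_inv_cancel, B.act_one]
  rw [B.act_mul, hs']

theorem exists_proj_eq (x : V) : ∃ p, B.proj p = x := by
  obtain ⟨O, -, hx, s, -, -, -, hps, -⟩ := B.exists_section x
  exact ⟨s x, hps x hx⟩

theorem exists_act_eq {p p' : P} (h : B.proj p = B.proj p') : ∃ g, B.act p g = p' := by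
  obtain ⟨O, -, hp, s, ψ, -, -, -, -, -, hsψ⟩ := B.exists_section (B.proj p)
  have h' := hsψ p' (h ▸ hp)
  rw [← h] at h'
  refine ⟨(ψ p)⁻¹ * ψ p', ?_⟩
  calc B.act p ((ψ p)⁻¹ * ψ p')
      = B.act (B.act (s (B.proj p)) (ψ p)) ((ψ p)⁻¹ * ψ p') := by rw [hsψ p hp]
    _ = p' := by rw [← B.act_mul, mul_inv_cancel_left, h']

theorem exists_modelDeriv_act_right_eq (p : P) (g : G) (w : EP) :
    ∃ v, modelDeriv EP EP (fun p => B.act p g) p v = w := by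
  refine ⟨modelDeriv EP EP (fun p => B.act p g⁻¹) (B.act p g) w, ?_⟩
  rw [← modelDeriv_comp (k := fun t => B.act (B.act t g⁻¹) g) (B.mdifferentiableAt_act_right p g)
    (B.mdifferentiableAt_act_right _ _) (by rw [← B.act_mul, mul_inv_cancel, B.act_one])
    (Eventually.of_forall fun _ => rfl)]
  exact modelDeriv_id (Eventually.of_forall fun t => by
    rw [← B.act_mul, inv_mul_cancel, B.act_one]) w

/-- The connection form, over a domain of the base, with local connection form `a` in the gauge
given by the fibre coordinate `ρ`. -/
def localConnection (ρ : P → G) (a : V → E →L[ℝ] F) (p : P) : EP →L[ℝ] F :=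
  (maurerCartan F (ρ p)).comp (modelDeriv EP F ρ p) +
    (modelAd F (ρ p)⁻¹).comp ((a (B.proj p)).comp (modelDeriv EP E B.proj p))

theorem localConnection_apply (ρ : P → G) (a : V → E →L[ℝ] F) (p : P) (v : EP) :
    B.localConnection ρ a p v = maurerCartan F (ρ p) (modelDeriv EP F ρ p v) +
      modelAd F (ρ p)⁻¹ (a (B.proj p) (modelDeriv EP E B.proj p v)) := rfl

/-! ### Connection forms in a local gauge -/

section LocalConnection

variable [LieGroup 𝓘(ℝ, F) ∞ G] {O : Set V} {ρ : P → G} {a : V → E →L[ℝ] F}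

/-- Along a fibre `ρ` is `g ↦ ρ p * g`, so the Maurer–Cartan term returns `A`; the other term is
pulled back from the base and vanishes. -/
theorem localConnection_fundamental (hO : IsOpen O)
    (hρ : ContMDiffOn 𝓘(ℝ, EP) 𝓘(ℝ, F) ∞ ρ (B.proj ⁻¹' O))
    (hact : ∀ p, B.proj p ∈ O → ∀ g, ρ (B.act p g) = ρ p * g)
    {p : P} (hp : B.proj p ∈ O) (A : F) :
    B.localConnection ρ a p (modelDeriv F EP (B.act p) 1 A) = A := by
  have hdρ : MDifferentiableAt 𝓘(ℝ, EP) 𝓘(ℝ, F) ρ p :=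
    (hρ.contMDiffAt ((B.isOpen_preimage hO).mem_nhds hp)).mdifferentiableAt (by simp)
  rw [localConnection_apply, B.modelDeriv_proj_fundamental, map_zero, map_zero, add_zero,
    ← modelDeriv_comp (k := fun g => ρ (B.act p g)) hdρ (B.mdifferentiableAt_act_left p 1)
      (B.act_one p) (Eventually.of_forall fun _ => rfl)]
  have hfun : (fun g => ρ (B.act p g)) = fun g => ρ p * g := funext fun g => hact p hp g
  rw [hfun, maurerCartan_modelDeriv (mdifferentiableAt_mul_left' _ _) (mul_one _)]
  exact modelDeriv_id (Eventually.of_forall fun z => by simp) A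

/-- Right translation by `g` multiplies `ρ` by `g`, and `Ad((ρ g)⁻¹) = Ad(g⁻¹) Ad(ρ⁻¹)`: both terms
acquire the same factor. -/
theorem localConnection_equivariant (hO : IsOpen O)
    (hρ : ContMDiffOn 𝓘(ℝ, EP) 𝓘(ℝ, F) ∞ ρ (B.proj ⁻¹' O))
    (hact : ∀ p, B.proj p ∈ O → ∀ g, ρ (B.act p g) = ρ p * g)
    {p : P} (hp : B.proj p ∈ O) (g : G) (v : EP) :
    B.localConnection ρ a (B.act p g) (modelDeriv EP EP (fun p => B.act p g) p v) =
      modelAd F g⁻¹ (B.localConnection ρ a p v) := by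
  have hpg : B.proj (B.act p g) ∈ O := by rwa [B.proj_act]
  have hd : ∀ p, B.proj p ∈ O → MDifferentiableAt 𝓘(ℝ, EP) 𝓘(ℝ, F) ρ p := fun p hp =>
    (hρ.contMDiffAt ((B.isOpen_preimage hO).mem_nhds hp)).mdifferentiableAt (by simp)
  rw [localConnection_apply, localConnection_apply, B.modelDeriv_proj_act_right, B.proj_act,
    ← modelDeriv_comp (k := fun p => ρ (B.act p g)) (hd _ hpg) (B.mdifferentiableAt_act_right p g)
      rfl (Eventually.of_forall fun _ => rfl), map_add, ← modelAd_mul, ← mul_inv_rev, ← hact p hp]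
  congr 1
  refine maurerCartan_mul_const (k := fun p => ρ (B.act p g)) (hd p hp) g ?_ v
  filter_upwards [(B.isOpen_preimage hO).mem_nhds hp] with t ht using hact t ht g

theorem contMDiffOn_localConnection [IsManifold 𝓘(ℝ, E) ∞ V] [IsManifold 𝓘(ℝ, EP) ∞ P]
    (hO : IsOpen O) (hρ : ContMDiffOn 𝓘(ℝ, EP) 𝓘(ℝ, F) ∞ ρ (B.proj ⁻¹' O))
    (ha : ContMDiffOn 𝓘(ℝ, E).tangent 𝓘(ℝ, F) ∞
      (fun w : TangentBundle 𝓘(ℝ, E) V => a w.1 w.vec) (TotalSpace.proj ⁻¹' O)) :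
    ContMDiffOn 𝓘(ℝ, EP).tangent 𝓘(ℝ, F) ∞
      (fun v : TangentBundle 𝓘(ℝ, EP) P => B.localConnection ρ a v.1 v.vec)
      (TotalSpace.proj ⁻¹' (B.proj ⁻¹' O)) := by
  have hπ : ContMDiff 𝓘(ℝ, EP).tangent 𝓘(ℝ, EP) ∞
      (TotalSpace.proj : TangentBundle 𝓘(ℝ, EP) P → P) :=
    Bundle.contMDiff_proj (TangentSpace 𝓘(ℝ, EP))
  have h1 := contMDiff_maurerCartan.comp_contMDiffOn
    (hρ.tangentMap_of_isOpen (B.isOpen_preimage hO))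
  have h2 := ha.comp (B.contMDiff_proj.contMDiffOn.tangentMap_of_isOpen
    (B.isOpen_preimage hO)) (fun v hv => hv)
  have h3 := hρ.inv.comp hπ.contMDiffOn
    (s := TotalSpace.proj ⁻¹' (B.proj ⁻¹' O)) (fun v hv => hv)
  exact h1.add (contMDiff_modelAd.comp_contMDiffOn (h3.prodMk h2))

end LocalConnection

end PrincipalBundle

section ConnectionForm

variable {F : Type*} [NormedAddCommGroup F] [NormedSpace ℝ F]
  {G : Type*} [TopologicalSpace G] [ChartedSpace F G] [Group G]
  {EP : Type*} [NormedAddCommGroup EP] [NormedSpace ℝ EP]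
  {P : Type*} [TopologicalSpace P] [ChartedSpace EP P] [IsManifold 𝓘(ℝ, EP) ∞ P]

/-- Moves the condition on fundamental fields from `act p 1` to `p`, and replaces tangent spaces by
model spaces. -/
theorem isConnectionForm_iff {act : P → G → P} (hact : ∀ p, act p 1 = p)
    (a : P → EP →L[ℝ] F) :
    IsConnectionForm (F := F) (EP := EP) act a ↔
      ContMDiff 𝓘(ℝ, EP).tangent 𝓘(ℝ, F) ∞
        (fun v : TangentBundle 𝓘(ℝ, EP) P => a v.1 v.vec) ∧
      (∀ p A, a p (modelDeriv F EP (act p) 1 A) = A) ∧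
      ∀ g p v, a (act p g) (modelDeriv EP EP (fun p => act p g) p v) =
        modelAd F g⁻¹ (a p v) := by
  constructor
  · rintro ⟨h1, h2, h3⟩
    refine ⟨h1, fun p A => ?_, h3⟩
    have h : a (act p 1) (modelDeriv F EP (act p) 1 A) = A := h2 p A
    rwa [hact] at h
  · rintro ⟨h1, h2, h3⟩
    refine ⟨h1, fun p A => ?_, h3⟩
    have h : a (act p 1) (modelDeriv F EP (act p) 1 A) = A := by
      rw [hact]; exact h2 p A
    exact h

end ConnectionForm

/-! ### Real and imaginary parts relative to a real form -/

section RealForm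

variable {EU : Type*} [NormedAddCommGroup EU] [NormedSpace ℝ EU]
  {F : Type*} [NormedAddCommGroup F] [NormedSpace ℂ F] [FiniteDimensional ℂ F]

/-- The real and imaginary parts with respect to a real form. -/
theorem exists_re_im_of_isCompl {L : EU →L[ℝ] F} (hL : Function.Injective L)
    (h : IsCompl L.range (L.range.map ((Complex.I • ContinuousLinearMap.id ℝ F : F →L[ℝ] F) :
      F →ₗ[ℝ] F))) :
    ∃ re im : F →L[ℝ] EU, (∀ z, L (re z) + Complex.I • L (im z) = z) ∧ ∀ u, re (L u) = u := by
  let T : EU × EU →ₗ[ℝ] F := (L : EU →ₗ[ℝ] F).coprod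
    (((Complex.I • ContinuousLinearMap.id ℝ F : F →L[ℝ] F) : F →ₗ[ℝ] F) ∘ₗ (L : EU →ₗ[ℝ] F))
  have hT : ∀ a b, T (a, b) = L a + Complex.I • L b := fun a b => rfl
  have hinj : Function.Injective T := by
    refine (injective_iff_map_eq_zero T).2 ?_
    rintro ⟨a, b⟩ hab
    rw [hT] at hab
    have h0 : L a = 0 := by
      refine (Submodule.disjoint_def.1 h.disjoint) _ ⟨a, rfl⟩ ⟨L (-b), ⟨-b, rfl⟩, ?_⟩
      change Complex.I • L (-b) = L a
      rw [map_neg, smul_neg, eq_neg_of_add_eq_zero_left hab]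
    rw [h0, zero_add] at hab
    have h1 : L b = 0 := (smul_eq_zero.1 hab).resolve_left Complex.I_ne_zero
    rw [← map_zero L] at h0 h1
    exact Prod.ext (hL h0) (hL h1)
  have hsurj : Function.Surjective T := by
    intro z
    have hz : z ∈ L.range ⊔ L.range.map
      ((Complex.I • ContinuousLinearMap.id ℝ F : F →L[ℝ] F) : F →ₗ[ℝ] F) := by
      rw [h.sup_eq_top]; trivial
    obtain ⟨y, ⟨a, rfl⟩, y', ⟨y'', ⟨b, rfl⟩, rfl⟩, rfl⟩ := Submodule.mem_sup.1 hz
    exact ⟨(a, b), rfl⟩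
  let e := LinearEquiv.ofBijective T ⟨hinj, hsurj⟩
  -- Makes the algebraic projections automatically continuous.
  have : FiniteDimensional ℝ F := FiniteDimensional.complexToReal F
  refine ⟨LinearMap.toContinuousLinearMap (LinearMap.fst ℝ EU EU ∘ₗ e.symm.toLinearMap),
    LinearMap.toContinuousLinearMap (LinearMap.snd ℝ EU EU ∘ₗ e.symm.toLinearMap),
    fun z => e.apply_symm_apply z, fun u => ?_⟩
  have : e (u, 0) = L u := by
    change L u + Complex.I • L 0 = L u
    rw [map_zero, smul_zero, add_zero]
  change (e.symm (L u)).1 = u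
  rw [← this, e.symm_apply_apply]

end RealForm

/-! ### Extensions of type (1,0): uniqueness, local existence, gluing -/

open Filter Topology

variable {E : Type*} [NormedAddCommGroup E] [NormedSpace ℂ E]
  {F : Type*} [NormedAddCommGroup F] [NormedSpace ℂ F]
  {EP : Type*} [NormedAddCommGroup EP] [NormedSpace ℂ EP]
  {EU : Type*} [NormedAddCommGroup EU] [NormedSpace ℝ EU]
  {EQ : Type*} [NormedAddCommGroup EQ] [NormedSpace ℝ EQ]
  {V : Type*} [TopologicalSpace V] [ChartedSpace E V]
  {G : Type*} [TopologicalSpace G] [ChartedSpace F G] [Group G]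
  {P : Type*} [TopologicalSpace P] [ChartedSpace EP P]
  {U : Type*} [TopologicalSpace U] [ChartedSpace EU U] [Group U]
  {Q : Type*} [TopologicalSpace Q] [ChartedSpace EQ Q]
  {BP : PrincipalBundle ω 𝓘(ℂ, E) 𝓘(ℂ, F) 𝓘(ℂ, EP) V G P}
  {BQ : PrincipalBundle ∞ 𝓘(ℝ, E) 𝓘(ℝ, EU) 𝓘(ℝ, EQ) V U Q}
  {ι : U →* G} {f : Q → P} {O O' : Set V} {α α' : P → EP →L[ℝ] F}

theorem zeroOnePart_eq_zero_iff (a : P → EP →L[ℝ] F) :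
    zeroOnePart (F := F) (G := G) (EP := EP) a = 0 ↔
      ∀ p v, a p (Complex.I • v) = Complex.I • a p v := by
  have key : ∀ p (v : EP), (zeroOnePart (F := F) (G := G) (EP := EP) a p : EP →L[ℝ] F) v =
      (2⁻¹ : ℝ) • (a p v + Complex.I • a p (Complex.I • v)) := fun p v => rfl
  have hI : ∀ x y : F, x + Complex.I • y = 0 ↔ y = Complex.I • x := fun x y => by
    constructor
    · intro h
      rw [eq_neg_of_add_eq_zero_left h, smul_neg, smul_smul, Complex.I_mul_I, neg_one_smul, neg_neg]
    · rintro rfl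
      rw [smul_smul, Complex.I_mul_I, neg_one_smul, add_neg_cancel]
  constructor
  · intro h p v
    have h0 : (zeroOnePart (F := F) (G := G) (EP := EP) a p : EP →L[ℝ] F) v = 0 := by
      rw [h]; rfl
    rw [key] at h0
    exact (hI _ _).1 ((smul_eq_zero.1 h0).resolve_left (by norm_num))
  · intro h
    funext p
    refine ContinuousLinearMap.ext fun v => ?_
    refine (key p v).trans ?_
    rw [(hI _ _).2 (h p v), smul_zero]
    rfl

/-- Over the set `O`, the form `α` is the extension to `P` of a connection on the reduction
`f : Q → P`, and is of type `(1, 0)`; no smoothness is required. -/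
structure IsHolomorphicExtensionOn (BP : PrincipalBundle ω 𝓘(ℂ, E) 𝓘(ℂ, F) 𝓘(ℂ, EP) V G P)
    (BQ : PrincipalBundle ∞ 𝓘(ℝ, E) 𝓘(ℝ, EU) 𝓘(ℝ, EQ) V U Q) (ι : U →* G) (f : Q → P)
    (O : Set V) (α : P → EP →L[ℝ] F) : Prop where
  fundamental : ∀ p, BP.proj p ∈ O → ∀ A, α p (modelDeriv F EP (BP.act p) 1 A) = A
  equivariant : ∀ p, BP.proj p ∈ O → ∀ g v,
    α (BP.act p g) (modelDeriv EP EP (fun p => BP.act p g) p v) = modelAd F g⁻¹ (α p v)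
  I_smul : ∀ p, BP.proj p ∈ O → ∀ v, α p (Complex.I • v) = Complex.I • α p v
  restrict : ∀ q, BQ.proj q ∈ O → ∀ v, α (f q) (modelDeriv EQ EP f q v) ∈
    (modelDeriv EU F ι 1).range

theorem IsReduction.mdifferentiableAt (hf : IsReduction BP BQ ι f) (q : Q) :
    MDifferentiableAt 𝓘(ℝ, EQ) 𝓘(ℝ, EP) f q :=
  hf.smooth.contMDiffAt.mdifferentiableAt (by simp)

variable [LieGroup 𝓘(ℂ, F) ω G]

/-- The uniqueness argument, with separate domains `O` and `O'` so that it also compares a local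
form with the glued one. -/
theorem IsHolomorphicExtensionOn.eq_of_mem (hreal : IsRealForm EU F ι)
    (hf : IsReduction BP BQ ι f)
    (h : IsHolomorphicExtensionOn BP BQ ι f O α) (h' : IsHolomorphicExtensionOn BP BQ ι f O' α')
    {p : P} (hp : BP.proj p ∈ O) (hp' : BP.proj p ∈ O') : α p = α' p := by
  obtain ⟨q, hq⟩ := BQ.exists_proj_eq (BP.proj p)
  have hfq : BP.proj (f q) = BP.proj p := (hf.proj_eq q).trans hq
  have hmem : ∀ v, (α (f q) - α' (f q)) v ∈ (modelDeriv EU F ι 1).range := by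
    intro v
    -- Split `v` into a vector tangent to `Q` with the same projection and a vertical remainder, on
    -- which both forms agree.
    obtain ⟨w, hw⟩ := BQ.exists_modelDeriv_proj_eq q (modelDeriv EP E BP.proj (f q) v)
    have hw' : modelDeriv EP E BP.real.proj (f q) (v - modelDeriv EQ EP f q w) = 0 := by
      rw [map_sub, ← modelDeriv_comp (k := BQ.proj) (BP.real.mdifferentiableAt_proj (f q))
        (hf.mdifferentiableAt q) rfl (Eventually.of_forall fun t => (hf.proj_eq t).symm), hw]
      exact sub_self _
    obtain ⟨A, hA⟩ := BP.real.exists_fundamental_eq hw'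
    have hv : v = modelDeriv F EP (BP.act (f q)) 1 A + modelDeriv EQ EP f q w :=
      sub_eq_iff_eq_add.1 hA.symm
    rw [hv, map_add, sub_apply, sub_apply,
      h.fundamental _ (hfq ▸ hp), h'.fundamental _ (hfq ▸ hp'), sub_self, zero_add]
    exact Submodule.sub_mem _ (h.restrict q (hq ▸ hp) w) (h'.restrict q (hq ▸ hp') w)
  have heq : ∀ v, α (f q) v = α' (f q) v := by
    intro v
    -- With `δ` the difference, `i δ(v) = δ(i v)` lies in `𝔲`, and `δ(v) ∈ 𝔲` puts it in `i𝔲` as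
    -- well.
    have h1 : Complex.I • (α (f q) - α' (f q)) v = 0 := by
      refine Submodule.disjoint_def.1 hreal.disjoint _ ?_ ⟨_, hmem v, rfl⟩
      have := hmem (Complex.I • v)
      rwa [sub_apply, h.I_smul _ (hfq ▸ hp), h'.I_smul _ (hfq ▸ hp'),
        ← smul_sub] at this
    exact sub_eq_zero.1 ((smul_eq_zero.1 h1).resolve_left Complex.I_ne_zero)
  -- Every point of the fibre is a translate of `f q`, and translation is onto on tangent vectors.
  obtain ⟨g, rfl⟩ := BP.real.exists_act_eq hfq
  ext w
  obtain ⟨v, rfl⟩ := BP.real.exists_modelDeriv_act_right_eq (f q) g w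
  exact (h.equivariant _ (hfq ▸ hp) g v).trans
    ((congrArg _ (heq v)).trans (h'.equivariant _ (hfq ▸ hp') g v).symm)

variable [FiniteDimensional ℂ F] [IsManifold 𝓘(ℂ, E) ω V] [IsManifold 𝓘(ℂ, EP) ω P]
  [LieGroup 𝓘(ℝ, EU) ∞ U]

theorem exists_isHolomorphicExtensionOn_nhds (hι : IsLieSubgroup EU F ι)
    (hreal : IsRealForm EU F ι) (hf : IsReduction BP BQ ι f) (x : V) :
    ∃ O : Set V, IsOpen O ∧ x ∈ O ∧ ∃ α : P → EP →L[ℝ] F,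
      IsHolomorphicExtensionOn BP BQ ι f O α ∧
      ContMDiffOn 𝓘(ℝ, EP).tangent 𝓘(ℝ, F) ∞
        (fun v : TangentBundle 𝓘(ℝ, EP) P => α v.1 v.vec)
        (TotalSpace.proj ⁻¹' (BP.proj ⁻¹' O)) := by
  obtain ⟨re, im, hz, -⟩ := exists_re_im_of_isCompl (L := modelDeriv EU F ι 1) hι.immersive hreal
  obtain ⟨O₁, hO₁, hx₁, -, ψ, -, hψω, -, -, hψact, -⟩ := BP.exists_section x
  obtain ⟨O₂, hO₂, hx₂, s, τ, hs, hτ, hps, -, -, hsτ⟩ := BQ.exists_section x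
  have hO : IsOpen (O₁ ∩ O₂) := hO₁.inter hO₂
  have hOP : IsOpen (BP.proj ⁻¹' (O₁ ∩ O₂)) := BP.real.isOpen_preimage hO
  have hψ : ContMDiffOn 𝓘(ℝ, EP) 𝓘(ℝ, F) ∞ ψ (BP.proj ⁻¹' (O₁ ∩ O₂)) :=
    hψω.restrictScalars_real.mono fun _ hp => hp.1
  let h : V → G := fun y => ψ (f (s y))
  have hpfs : ∀ y ∈ O₂, BP.proj (f (s y)) = y := fun y hy => (hf.proj_eq _).trans (hps y hy)
  have hsm : ContMDiffOn 𝓘(ℝ, E) 𝓘(ℝ, F) ∞ h (O₁ ∩ O₂) :=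
    hψ.comp ((hf.smooth.comp_contMDiffOn hs).mono Set.inter_subset_right) fun y hy => by
      change BP.proj (f (s y)) ∈ O₁ ∩ O₂
      rw [hpfs y hy.2]; exact hy
  set ρ : P → G := fun p => (h (BP.proj p))⁻¹ * ψ p with hρdef
  have hhπ : ContMDiffOn 𝓘(ℝ, EP) 𝓘(ℝ, F) ∞ (fun p => h (BP.proj p))
      (BP.proj ⁻¹' (O₁ ∩ O₂)) :=
    hsm.comp BP.real.contMDiff_proj.contMDiffOn fun _ hp => hp
  have hρ : ContMDiffOn 𝓘(ℝ, EP) 𝓘(ℝ, F) ∞ ρ (BP.proj ⁻¹' (O₁ ∩ O₂)) := hhπ.inv.mul hψ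
  have hρact : ∀ p, BP.proj p ∈ O₁ ∩ O₂ → ∀ g, ρ (BP.act p g) = ρ p * g := fun p hp g => by
    simp only [hρdef]
    rw [BP.proj_act, hψact p hp.1, mul_assoc]
  let β : V → E →L[ℝ] F := fun y => (maurerCartan F (h y)).comp (modelDeriv E F h y)
  let mulI : E →L[ℝ] E := Complex.I • ContinuousLinearMap.id ℝ E
  -- The `𝔲`-valued form with the same `(0,1)` part as `β`.
  let a : V → E →L[ℝ] F := fun y =>
    (modelDeriv EU F ι 1).comp (re.comp (β y) - im.comp ((β y).comp mulI))
  have ha_apply : ∀ y w, a y w = modelDeriv EU F ι 1 (re (β y w) - im (β y (Complex.I • w))) :=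
    fun y w => rfl
  have hβ : ContMDiffOn 𝓘(ℝ, E).tangent 𝓘(ℝ, F) ∞
      (fun w : TangentBundle 𝓘(ℝ, E) V => β w.1 w.vec) (TotalSpace.proj ⁻¹' (O₁ ∩ O₂)) :=
    contMDiff_maurerCartan.comp_contMDiffOn (hsm.tangentMap_of_isOpen hO)
  have ha : ContMDiffOn 𝓘(ℝ, E).tangent 𝓘(ℝ, F) ∞
      (fun w : TangentBundle 𝓘(ℝ, E) V => a w.1 w.vec) (TotalSpace.proj ⁻¹' (O₁ ∩ O₂)) := by
    have hβI := hβ.comp contMDiff_tangentBundle_I_smul.contMDiffOn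
      (s := TotalSpace.proj ⁻¹' (O₁ ∩ O₂)) fun w hw => hw
    exact (modelDeriv EU F ι 1).contMDiff.comp_contMDiffOn
      ((re.contMDiff.comp_contMDiffOn hβ).sub (im.contMDiff.comp_contMDiffOn hβI))
  refine ⟨O₁ ∩ O₂, hO, ⟨hx₁, hx₂⟩, BP.real.localConnection ρ a, ⟨?_, ?_, ?_, ?_⟩,
    BP.real.contMDiffOn_localConnection hO hρ ha⟩
  · exact fun p hp A => BP.real.localConnection_fundamental hO hρ hρact hp A
  · exact fun p hp g v => BP.real.localConnection_equivariant hO hρ hρact hp g v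
  · intro p hp
    have hd : ∀ {k : P → G}, ContMDiffOn 𝓘(ℝ, EP) 𝓘(ℝ, F) ∞ k (BP.proj ⁻¹' (O₁ ∩ O₂)) →
        MDifferentiableAt 𝓘(ℝ, EP) 𝓘(ℝ, F) k p := fun hk =>
      (hk.contMDiffAt (hOP.mem_nhds hp)).mdifferentiableAt (by simp)
    have hdh : MDifferentiableAt 𝓘(ℝ, E) 𝓘(ℝ, F) h (BP.proj p) :=
      (hsm.contMDiffAt (hO.mem_nhds hp)).mdifferentiableAt (by simp)
    have hform : ∀ v, BP.real.localConnection ρ a p v =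
        maurerCartan F (ψ p) (modelDeriv EP F ψ p v) +
          modelAd F (ρ p)⁻¹ (a (BP.proj p) (modelDeriv EP E BP.proj p v) -
            β (BP.proj p) (modelDeriv EP E BP.proj p v)) := by
      intro v
      have h1 := maurerCartan_mul (k := ψ) (hd hhπ) (hd hρ)
        (Eventually.of_forall fun t => (mul_inv_cancel_left _ _).symm) v
      rw [modelDeriv_comp (k := fun t => h (BP.proj t)) hdh (BP.real.mdifferentiableAt_proj p) rfl
        (Eventually.of_forall fun _ => rfl)] at h1
      rw [PrincipalBundle.localConnection_apply, h1, map_sub, add_assoc]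
      exact congrArg₂ _ rfl (add_sub_cancel _ _).symm
    -- In this form complex linearity is visible: `w ↦ φ(i w) + i φ(w)` commutes with `i` for every
    -- real linear `φ`.
    have hab : ∀ w, a (BP.proj p) w - β (BP.proj p) w =
        -(modelDeriv EU F ι 1 (im (β (BP.proj p) (Complex.I • w))) +
          Complex.I • modelDeriv EU F ι 1 (im (β (BP.proj p) w))) := by
      intro w
      rw [ha_apply, map_sub, eq_sub_of_add_eq (hz (β (BP.proj p) w))]
      abel
    have hψI : ∀ v, modelDeriv EP F ψ p (Complex.I • v) = Complex.I • modelDeriv EP F ψ p v :=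
      modelDeriv_I_smul ((hψω.contMDiffAt ((BP.real.isOpen_preimage hO₁).mem_nhds
        hp.1)).mdifferentiableAt (by simp))
    have hπI : ∀ v, modelDeriv EP E BP.proj p (Complex.I • v) =
        Complex.I • modelDeriv EP E BP.proj p v :=
      modelDeriv_I_smul (BP.contMDiff_proj.contMDiffAt.mdifferentiableAt (by simp))
    intro v
    rw [hform, hform, hψI, hπI, hab, hab, maurerCartan_I_smul, smul_add, ← modelAd_I_smul,
      smul_smul, Complex.I_mul_I, neg_one_smul]
    simp only [map_neg, smul_neg, smul_add, smul_smul, Complex.I_mul_I, neg_one_smul]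
    rw [add_comm (-(modelDeriv EU F ι 1 _))]
  · intro q hq u
    have hOQ := (BQ.isOpen_preimage hO).mem_nhds (show q ∈ BQ.proj ⁻¹' (O₁ ∩ O₂) from hq)
    -- The gauge `ρ` is adapted to `Q`: on `f(Q)` it is the fibre coordinate `τ` of `Q`. Hence both
    -- terms of the connection restrict to `𝔲`-valued forms.
    have hρf : ∀ t ∈ BQ.proj ⁻¹' (O₁ ∩ O₂), ρ (f t) = ι (τ t) := by
      intro t ht
      have h1 : f t = BP.act (f (s (BQ.proj t))) (ι (τ t)) := by
        rw [← hf.equivariant, hsτ t ht.2]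
      have h2 : ψ (f t) = h (BQ.proj t) * ι (τ t) := by
        conv_lhs => rw [h1]
        exact hψact _ (by rw [hpfs _ ht.2]; exact ht.1) _
      simp only [hρdef]
      rw [hf.proj_eq, h2, inv_mul_cancel_left]
    have hfq : f q ∈ BP.proj ⁻¹' (O₁ ∩ O₂) := by
      rw [Set.mem_preimage, hf.proj_eq]; exact hq
    have hdρ : MDifferentiableAt 𝓘(ℝ, EP) 𝓘(ℝ, F) ρ (f q) :=
      (hρ.contMDiffAt (hOP.mem_nhds hfq)).mdifferentiableAt (by simp)
    have hdτ : MDifferentiableAt 𝓘(ℝ, EQ) 𝓘(ℝ, EU) τ q :=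
      (hτ.contMDiffAt ((BQ.isOpen_preimage hO₂).mem_nhds hq.2)).mdifferentiableAt (by simp)
    rw [PrincipalBundle.localConnection_apply,
      ← modelDeriv_comp (k := fun t => ρ (f t)) hdρ (hf.mdifferentiableAt q) rfl
        (Eventually.of_forall fun _ => rfl)]
    refine Submodule.add_mem _ ?_ ?_
    · exact ⟨_, (maurerCartan_map (k := fun t => ρ (f t)) hι.smooth hdτ
        (eventually_of_mem hOQ hρf) u).symm⟩
    · rw [hρf q hq, ha_apply, ← map_inv, modelAd_map hι.smooth]
      exact ⟨_, rfl⟩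

/-- The extension to `P` of the canonical connection of a reduction. -/
theorem exists_isHolomorphicExtensionOn_univ (hι : IsLieSubgroup EU F ι)
    (hreal : IsRealForm EU F ι) (hf : IsReduction BP BQ ι f) :
    ∃ α : P → EP →L[ℝ] F, IsHolomorphicExtensionOn BP BQ ι f Set.univ α ∧
      ContMDiff 𝓘(ℝ, EP).tangent 𝓘(ℝ, F) ∞
        (fun v : TangentBundle 𝓘(ℝ, EP) P => α v.1 v.vec) := by
  choose O hO hx α hα hsm using exists_isHolomorphicExtensionOn_nhds hι hreal hf
  -- At `p` use the local form chosen for `π p`, a choice constant along fibres. All conditions but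
  -- smoothness are checked within single fibres, so they hold before any gluing.
  have hext : IsHolomorphicExtensionOn BP BQ ι f Set.univ (fun p => α (BP.proj p) p) := by
    refine ⟨fun p _ => (hα _).fundamental p (hx _), fun p _ g v => ?_,
      fun p _ => (hα _).I_smul p (hx _), fun q _ v => ?_⟩
    · simp only [BP.proj_act]
      exact (hα _).equivariant p (hx _) g v
    · exact (hα _).restrict q (by rw [← hf.proj_eq]; exact hx _) v
  refine ⟨_, hext, fun v₀ => ?_⟩
  have hU : TotalSpace.proj ⁻¹' (BP.proj ⁻¹' O (BP.proj v₀.1)) ∈ 𝓝 v₀ :=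
    ((BP.real.isOpen_preimage (hO _)).preimage
      (FiberBundle.continuous_proj EP (TangentSpace 𝓘(ℝ, EP)))).mem_nhds (hx _)
  -- By uniqueness the glued form coincides near `v₀` with the one smooth local form chosen at `π
  -- v₀`.
  refine ((hsm (BP.proj v₀.1)).contMDiffAt hU).congr_of_eventuallyEq ?_
  filter_upwards [hU] with v hv
  exact DFunLike.congr_fun (hext.eq_of_mem hreal hf (hα _) trivial hv) v.vec

end

/-! ### The canonical connection of the reduction -/

theorem mainTheorem5
    {E : Type*} [NormedAddCommGroup E] [NormedSpace ℂ E] [FiniteDimensional ℂ E]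
    {F : Type*} [NormedAddCommGroup F] [NormedSpace ℂ F] [FiniteDimensional ℂ F]
    {EP : Type*} [NormedAddCommGroup EP] [NormedSpace ℂ EP] [FiniteDimensional ℂ EP]
    {EU : Type*} [NormedAddCommGroup EU] [NormedSpace ℝ EU] [FiniteDimensional ℝ EU]
    {EQ : Type*} [NormedAddCommGroup EQ] [NormedSpace ℝ EQ] [FiniteDimensional ℝ EQ]
    {V : Type*} [TopologicalSpace V] [T2Space V] [ChartedSpace E V] [IsManifold 𝓘(ℂ, E) ω V]
    {G : Type*} [TopologicalSpace G] [ChartedSpace F G] [Group G] [LieGroup 𝓘(ℂ, F) ω G]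
    {P : Type*} [TopologicalSpace P] [ChartedSpace EP P] [IsManifold 𝓘(ℂ, EP) ω P]
    {U : Type*} [TopologicalSpace U] [ChartedSpace EU U] [Group U] [LieGroup 𝓘(ℝ, EU) ∞ U]
    {Q : Type*} [TopologicalSpace Q] [ChartedSpace EQ Q] [IsManifold 𝓘(ℝ, EQ) ∞ Q]
    (BP : PrincipalBundle ω 𝓘(ℂ, E) 𝓘(ℂ, F) 𝓘(ℂ, EP) V G P)
    (BQ : PrincipalBundle ∞ 𝓘(ℝ, E) 𝓘(ℝ, EU) 𝓘(ℝ, EQ) V U Q)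
    (ι : U →* G) (hι : IsLieSubgroup EU F ι) (hreal : IsRealForm EU F ι)
    (f : Q → P) (hf : IsReduction BP BQ ι f) :
    ∃! θ : LieValuedForm EU U EQ Q, IsConnectionForm BQ.act θ ∧
      ∃ α : LieValuedForm F G EP P, IsExtension BP ι f θ α ∧ zeroOnePart α = 0 := by

  have hιd : MDifferentiableAt 𝓘(ℝ, EU) 𝓘(ℝ, F) ι 1 :=
    hι.smooth.contMDiffAt.mdifferentiableAt (by simp)
  obtain ⟨re, im, -, hre⟩ :=
    exists_re_im_of_isCompl (L := modelDeriv EU F ι 1) hι.immersive hreal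
  obtain ⟨α, hα, hαs⟩ := exists_isHolomorphicExtensionOn_univ hι hreal hf
  -- The pullback `f^*α` takes values in `ι_* 𝔲`, where `re` inverts `ι_*`.
  let θ : Q → EQ →L[ℝ] EU := fun q => re.comp ((α (f q)).comp (modelDeriv EQ EP f q))
  have hθ : ∀ q v, modelDeriv EU F ι 1 (θ q v) = α (f q) (modelDeriv EQ EP f q v) := by
    intro q v
    obtain ⟨u, hu⟩ := hα.restrict q trivial v
    change modelDeriv EU F ι 1 (re (α (f q) (modelDeriv EQ EP f q v))) = _
    rw [← hu]
    exact congrArg _ (hre u)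
  have hinj : Function.Injective (modelDeriv EU F ι 1) := hι.immersive
  have hext : IsExtension BP ι f θ α := by
    refine ⟨(isConnectionForm_iff BP.act_one α).2 ⟨hαs, fun p => hα.fundamental p trivial,
      fun g p => hα.equivariant p trivial g⟩, fun q v => (hθ q v).symm⟩
  refine ⟨θ, ⟨(isConnectionForm_iff BQ.act_one θ).2 ⟨?_, fun q A => hinj ?_,
    fun u q v => hinj ?_⟩, α, hext, (zeroOnePart_eq_zero_iff α).2 fun p => hα.I_smul p trivial⟩, ?_⟩
  · have h1 : ContMDiff 𝓘(ℝ, EQ).tangent 𝓘(ℝ, EP).tangent ∞ (fun v : TangentBundle 𝓘(ℝ, EQ) Q =>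
        TangentBundle.ofVec (f v.1) (modelDeriv EQ EP f v.1 v.vec)) :=
      contMDiffOn_univ.1 (hf.smooth.contMDiffOn.tangentMap_of_isOpen isOpen_univ)
    exact re.contMDiff.comp (hαs.comp h1)
  -- After applying the injective `ι_*`, this is the derivative of `f (q · u) = f q · ι u` in `u`;
  -- the next case differentiates the same identity in `q`.
  · rw [hθ, ← modelDeriv_comp (k := fun u => BP.act (f q) (ι u)) (hf.mdifferentiableAt q)
      (BQ.mdifferentiableAt_act_left q 1) (BQ.act_one q)
      (Filter.Eventually.of_forall fun u => (hf.equivariant q u).symm),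
      modelDeriv_comp (k := fun u => BP.act (f q) (ι u)) (BP.real.mdifferentiableAt_act_left _ 1)
        hιd (map_one ι) (Filter.Eventually.of_forall fun _ => rfl)]
    exact hα.fundamental _ trivial _
  · rw [hθ, ← modelAd_map hι.smooth, hθ, map_inv, ← hα.equivariant _ trivial,
      ← modelDeriv_comp (k := fun t => BP.act (f t) (ι u)) (g := fun p => BP.act p (ι u))
        (BP.real.mdifferentiableAt_act_right _ _)
        (hf.mdifferentiableAt q) rfl (Filter.Eventually.of_forall fun _ => rfl),
      ← modelDeriv_comp (k := fun t => BP.act (f t) (ι u)) (hf.mdifferentiableAt _)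
        (BQ.mdifferentiableAt_act_right q u) rfl
        (Filter.Eventually.of_forall fun t => (hf.equivariant t u).symm), hf.equivariant]
  · rintro θ' ⟨-, α', ⟨hconn, hres⟩, hzero⟩
    obtain ⟨-, hfund, hequiv⟩ := (isConnectionForm_iff (F := F) (EP := EP) BP.act_one α').1 hconn
    -- Any competing extension satisfies the same conditions, so it equals `α` along `f(Q)`, and
    -- injectivity of `ι_*` then determines the connection on `Q`.
    have hα' : IsHolomorphicExtensionOn BP BQ ι f Set.univ α' :=
      ⟨fun p _ => hfund p, fun p _ g => hequiv g p,
        fun p _ => (zeroOnePart_eq_zero_iff (F := F) (EP := EP) α').1 hzero p,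
        fun q _ v => ⟨_, (hres q v).symm⟩⟩
    funext q
    refine ContinuousLinearMap.ext fun v => hinj ?_
    refine (hres q v).symm.trans (Eq.trans ?_ (hθ q v).symm)
    exact congrArg (fun φ : EP →L[ℝ] F => φ (modelDeriv EQ EP f q v))
      (hα'.eq_of_mem hreal hf hα (p := f q) trivial trivial)
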